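/- Let $d\in\mathbb N$, let $P,Q$ be Borel probability measures on $\mathbb R^d$, and let $(X_t)_{t\ge1}$ and $(Y_s)_{s\ge1}$ be mutually independent sequences of i.i.d. random variables with laws $P$ and $Q$ respectively, with empirical measures $P_t=\frac1t\sum_{i=1}^t\delta_{X_i}$ and $Q_s=\frac1s\sum_{j=1}^s\delta_{Y_j}$. Let $K:\mathbb R^d\times\mathbb R^d\to[0,\infty)$ be a Mercer kernel, i.e. a symmetric continuous function such that $(K(x_i,x_j))_{i,j=1}^n$ is positive semidefinite for all $x_1,\dots,x_n\in\mathbb R^d$, and suppose $K(x,y)\le B<\infty$ for all $x,y$. Let $\mathcal H$ be the reproducing kernel Hilbert space of $K$, and for probability measures $\mu,\nu$ let $$\mathrm{MMD}(\mu,\nu)=\sup_{f\in\mathcal H,\ \|f\|_{\mathcal H}\le1}\Big(\int f\,d\mu-\int f\,d\nu\Big).$$ Let $\ell,g:[0,\infty)\to[1,\infty)$ be nondecreasing functions such that $\ell$ is constant on $[0,1]$, $g$ is constant on $[0,2]$, and $$\sum_{k=1}^\infty\frac1{\ell(k)}\le1,\qquad \sum_{j,k=1}^\infty\frac{e}{g(j+k)}\le1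 .$$ For $\delta\in(0,1)$ and integers $t,s\ge1$ define $$\gamma_{ts}=2\sqrt{2B}\,\big(t^{-1/2}+s^{-1/2}\big)+4\sqrt{\frac{B(t+s)}{ts}\Big[\log g(\log_2t+\log_2s)+\log(2/\delta)\Big]},$$ $$\kappa_t=\sqrt{\frac{\log\ell(\log_2t)+\log(4/\delta)}{t}},\qquad \kappa_{ts}=\kappa_t+\kappa_s .$$ Then $$\mathbb P\Big(\forall t,s\ge1:\ -\gamma_{ts}\le\mathrm{MMD}(P,Q)-\mathrm{MMD}(P_t,Q_s)\le2\sqrt B\,\kappa_{ts}\Big)\ge1-\delta .$$ Moreover, if $g$ is bounded above on $[0,\infty)$ by a polynomial, then there is a constant $C$ (depending only on $B,\delta,g$) such that $\gamma_{ts}\le C\sqrt{\log\log(t\vee s)/(t\wedge s)}$ for all $t,s\ge1$ with $t\vee s\ge3$. -/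

import Mathlib

open MeasureTheory ProbabilityTheory
open scoped ENNReal

noncomputable section

/-- `d`-dimensional Euclidean space. -/
abbrev Eucl (d : ℕ) : Type := EuclideanSpace ℝ (Fin d)

/-! ### Kernels and their reproducing kernel Hilbert spaces -/

/-- A Mercer kernel on `X`: a continuous symmetric function `X × X → [0, ∞)` all of whose
finite Gram matrices are positive semidefinite. -/
structure IsMercerKernel {X : Type*} [TopologicalSpace X] (K : X → X → ℝ) : Prop where
  nonneg : ∀ x y, 0 ≤ K x y
  symm : ∀ x y, K x y = K y x
  continuous : Continuous fun z : X × X => K z.1 z.2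
  posSemidef : ∀ (n : ℕ) (x : Fin n → X),
    (Matrix.of fun i j : Fin n => K (x i) (x j)).PosSemidef

/-- A scalar kernel, seen as a kernel whose values are operators on `ℝ` (multiplication by
`K x y`), which is the form in which Mathlib constructs reproducing kernel Hilbert spaces. -/
def kernelMatrix {X : Type*} (K : X → X → ℝ) : Matrix X X (ℝ →L[ℝ] ℝ) :=
  Matrix.of fun x y => K x y • ContinuousLinearMap.id ℝ ℝ

theorem IsMercerKernel.posSemidef_kernelMatrix {X : Type*} [TopologicalSpace X]
    {K : X → X → ℝ} (hK : IsMercerKernel K) : (kernelMatrix K).PosSemidef := by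
  have key := (RKHS.posSemidef_tfae (K := kernelMatrix K)).out 0 2
  rw [key]
  refine ⟨?_, ?_⟩
  · ext x y
    have h : ContinuousLinearMap.adjoint (ContinuousLinearMap.id ℝ ℝ)
        = ContinuousLinearMap.id ℝ ℝ :=
      (IsSelfAdjoint.one (ℝ →L[ℝ] ℝ)).adjoint_eq
    simp [kernelMatrix, Matrix.conjTranspose_apply, hK.symm x y,
      ContinuousLinearMap.star_eq_adjoint, h]
  · intro v
    have h := (hK.posSemidef v.support.card
      (fun i => (v.support.equivFin.symm i : X))).dotProduct_mulVec_nonneg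
      (fun i => v (v.support.equivFin.symm i : X))
    refine le_of_le_of_eq h ?_
    simp only [dotProduct, Matrix.mulVec, Finsupp.sum, kernelMatrix, Matrix.of_apply,
      Finset.mul_sum, RCLike.re_to_real]
    rw [← Finset.sum_coe_sort v.support,
      ← Equiv.sum_comp v.support.equivFin.symm]
    refine Finset.sum_congr rfl fun i _ => ?_
    rw [← Finset.sum_coe_sort v.support,
      ← Equiv.sum_comp v.support.equivFin.symm]
    refine Finset.sum_congr rfl fun j _ => ?_
    simp [hK.symm (v.support.equivFin.symm i : X)]
    ring

/-! ### Integral probability metrics and the maximum mean discrepancy -/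

/-- The integral probability metric `sup_{f ∈ J} (∫ f dP - ∫ f dQ)` generated by the class `J`. -/
def ipm {X : Type*} [MeasurableSpace X] (J : Set (X → ℝ)) (P Q : Measure X) : ℝ :=
  sSup ((fun f : X → ℝ => (∫ x, f x ∂P) - ∫ x, f x ∂Q) '' J)

/-- The closed unit ball of a reproducing kernel Hilbert space, as a set of functions. -/
def rkhsUnitBall {X : Type*} (H : Type*) [NormedAddCommGroup H] [InnerProductSpace ℝ H]
    [RKHS ℝ H X ℝ] : Set (X → ℝ) :=
  {u | ∃ f : H, ‖f‖ ≤ 1 ∧ u = ⇑f}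

/-- The maximum mean discrepancy: the integral probability metric generated by the unit ball of
the reproducing kernel Hilbert space of `K`, the completion of the span of the functions
`K(·, x)` for the inner product with `⟨K(·, x), K(·, y)⟩ = K(x, y)`. -/
def mmd {X : Type*} [TopologicalSpace X] [MeasurableSpace X] {K : X → X → ℝ}
    (hK : IsMercerKernel K) (P Q : Measure X) : ℝ :=
  haveI : Fact (kernelMatrix K).PosSemidef := ⟨hK.posSemidef_kernelMatrix⟩
  ipm (rkhsUnitBall (RKHS.OfKernel (kernelMatrix K))) P Q

/-- The empirical measure `(1 / t) ∑ δ_{X_i(ω)}` of the first `t` terms of a sequence. The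
sequence is indexed from `0`, so these are `X 0, …, X (t - 1)`. -/
def empMeasure {Ω X : Type*} [MeasurableSpace X] (Z : ℕ → Ω → X) (t : ℕ) (ω : Ω) : Measure X :=
  (t : ℝ≥0∞)⁻¹ • ∑ i ∈ Finset.range t, Measure.dirac (Z i ω)

/-- The variables `Z 0, Z 1, …` are independent and all have law `P`. -/
structure IsIIDSample {Ω X : Type*} [MeasurableSpace Ω] [MeasurableSpace X]
    (Z : ℕ → Ω → X) (P : Measure X) (μ : Measure Ω) : Prop where
  measurable : ∀ i, Measurable (Z i)
  indep : iIndepFun Z μ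
  law : ∀ i, μ.map (Z i) = P

/-! ### Stitching functions and the confidence bounds -/

/-- One-sample stitching functions `ℓ : [0, ∞) → [1, ∞)`: nondecreasing, constant on `[0, 1]`,
with `∑_{k ≥ 1} 1 / ℓ(k) ≤ 1`. Values at negative arguments are never used. -/
structure IsStitchingOne (l : ℝ → ℝ) : Prop where
  one_le : ∀ x, 0 ≤ x → 1 ≤ l x
  mono : MonotoneOn l (Set.Ici 0)
  const : ∀ x ∈ Set.Icc (0 : ℝ) 1, l x = l 1
  summable : Summable fun k : ℕ => 1 / l ((k : ℝ) + 1)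
  tsum_le : ∑' k : ℕ, 1 / l ((k : ℝ) + 1) ≤ 1

/-- Two-sample stitching functions `g : [0, ∞) → [1, ∞)`: nondecreasing, constant on `[0, 2]`,
with `∑_{j, k ≥ 1} e / g(j + k) ≤ 1`. Values at negative arguments are never used. -/
structure IsStitchingTwo (g : ℝ → ℝ) : Prop where
  one_le : ∀ x, 0 ≤ x → 1 ≤ g x
  mono : MonotoneOn g (Set.Ici 0)
  const : ∀ x ∈ Set.Icc (0 : ℝ) 2, g x = g 2
  summable : Summable fun p : ℕ × ℕ =>
    Real.exp 1 / g (((p.1 : ℝ) + 1) + ((p.2 : ℝ) + 1))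
  tsum_le : ∑' p : ℕ × ℕ, Real.exp 1 / g (((p.1 : ℝ) + 1) + ((p.2 : ℝ) + 1)) ≤ 1

/-- `κ_t = √((log ℓ(log₂ t) + log (4 / δ)) / t)`. -/
def kappaOne (l : ℝ → ℝ) (δ : ℝ) (t : ℕ) : ℝ :=
  √((Real.log (l (Real.logb 2 t)) + Real.log (4 / δ)) / t)

/-- `κ_{ts} = κ_t + κ_s`. -/
def kappaTwo (l : ℝ → ℝ) (δ : ℝ) (t s : ℕ) : ℝ :=
  kappaOne l δ t + kappaOne l δ s

/-- `γ_{ts} = 2 √(2B) (t^{-1/2} + s^{-1/2})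
  + 4 √((B (t + s) / (t s)) (log g(log₂ t + log₂ s) + log (2 / δ)))`. -/
def gammaMMD (g : ℝ → ℝ) (B δ : ℝ) (t s : ℕ) : ℝ :=
  2 * √(2 * B) * ((t : ℝ) ^ (-(1 / 2) : ℝ) + (s : ℝ) ^ (-(1 / 2) : ℝ))
    + 4 * √(B * ((t : ℝ) + s) / ((t : ℝ) * s)
        * (Real.log (g (Real.logb 2 t + Real.logb 2 s)) + Real.log (2 / δ)))

end

/-! By the reproducing property, the MMD is the Hilbert norm distance between mean embeddings
(`ipm_rkhsUnitBall`). The two sides of the confidence band then come from different concentration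
arguments.

For the lower side, the triangle inequality reduces the claim to bounding the deviation of each
empirical embedding from its mean. That deviation is an average of centred vectors of norm at most
`√(2B)`. A dimension-free maximal inequality comes from Pinelis' method: `cosh` of the norm of a
martingale gains at most a factor `cosh b` per step in expectation (`cosh_norm_add_le`), and Doob's
inequality makes the bound uniform over a time block. Since the whole norm is controlled, no
separate bound on its expectation is needed.

For the upper side, the unit vector `f` realising the population MMD is deterministic and is only a
competitor for the empirical MMD. Scalar sums of `f` over the samples therefore suffice, and
Hoeffding's lemma with Doob controls them one-sidedly.

Each bound is made uniform in time by stitching over dyadic epochs, the stitching function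
distributing the error probability among them. Each sample contributes two bad events of probability
at most `δ / 4`. Splitting `γ` into two one-sample radii (`gammaOne`) means that the two-sample
function `g` is used only through a single row of its double series. -/

/-! ### A maximal inequality for martingale sums in a Hilbert space -/

section Maximal

variable {Ω : Type*} {m0 : MeasurableSpace Ω} {μ : Measure Ω}

/-- Doob's maximal inequality, with a real threshold. -/
theorem Submartingale.measure_exists_le_le [IsFiniteMeasure μ] {𝓕 : Filtration ℕ m0}
    {f : ℕ → Ω → ℝ} (hf : Submartingale f 𝓕 μ) (hf0 : 0 ≤ f) {r : ℝ} (hr : 0 < r) (n : ℕ) :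
    μ {ω | ∃ k ≤ n, r ≤ f k ω} ≤ ENNReal.ofReal ((∫ ω, f n ω ∂μ) / r) := by
  have h := maximal_ineq hf hf0 (ε := r.toNNReal) n
  have hset : {ω | ((r.toNNReal : NNReal) : ℝ) ≤ (Finset.range (n + 1)).sup'
      Finset.nonempty_range_add_one fun k => f k ω} = {ω | ∃ k ≤ n, r ≤ f k ω} := by
    ext ω
    simp [Finset.le_sup'_iff, hr.le]
  rw [hset] at h
  have hle : ENNReal.ofReal (∫ ω in {ω | ∃ k ≤ n, r ≤ f k ω}, f n ω ∂μ) ≤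
      ENNReal.ofReal (∫ ω, f n ω ∂μ) :=
    ENNReal.ofReal_le_ofReal (setIntegral_le_integral (hf.integrable n)
      (Filter.Eventually.of_forall (hf0 n)))
  rw [ENNReal.ofReal_div_of_pos hr,
    ENNReal.le_div_iff_mul_le (Or.inl (by simpa using hr)) (Or.inl ENNReal.ofReal_ne_top),
    mul_comm]
  exact h.trans hle

variable {E : Type*} [NormedAddCommGroup E]

/-- A bounded martingale difference sequence: adapted, bounded by `b`, with vanishing conditional
expectations given the past. -/
structure IsBoundedMartingaleDiff [NormedSpace ℝ E] [CompleteSpace E] (ξ : ℕ → Ω → E)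
    (𝓕 : Filtration ℕ m0) (b : ℝ) (μ : Measure Ω) : Prop where
  adapted : ∀ i, StronglyMeasurable[𝓕 i] (ξ i)
  bound : ∀ i ω, ‖ξ i ω‖ ≤ b
  condExp : ∀ i, μ[ξ (i + 1)|𝓕 i] =ᵐ[μ] 0
  integral_zero : ∫ ω, ξ 0 ω ∂μ = 0

namespace IsBoundedMartingaleDiff

section Banach

variable [NormedSpace ℝ E] [CompleteSpace E] {ξ : ℕ → Ω → E} {𝓕 : Filtration ℕ m0} {b : ℝ}

theorem stronglyMeasurable_sum (h : IsBoundedMartingaleDiff ξ 𝓕 b μ) (n : ℕ) :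
    StronglyMeasurable[𝓕 n] fun ω => ∑ i ∈ Finset.range (n + 1), ξ i ω := by
  refine Finset.stronglyMeasurable_fun_sum _ fun i hi => ?_
  exact (h.adapted i).mono (𝓕.mono (Nat.lt_succ_iff.1 (Finset.mem_range.1 hi)))

theorem norm_sum_le (h : IsBoundedMartingaleDiff ξ 𝓕 b μ) (n : ℕ) (ω : Ω) :
    ‖∑ i ∈ Finset.range n, ξ i ω‖ ≤ n * b := by
  refine (_root_.norm_sum_le _ _).trans ((Finset.sum_le_sum fun i _ => h.bound i ω).trans ?_)
  simp

theorem integrable [IsFiniteMeasure μ] (h : IsBoundedMartingaleDiff ξ 𝓕 b μ) (i : ℕ) :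
    Integrable (ξ i) μ :=
  Integrable.of_bound ((h.adapted i).mono (𝓕.le i)).aestronglyMeasurable b
    (Filter.Eventually.of_forall (h.bound i))

theorem integrable_sum [IsFiniteMeasure μ] (h : IsBoundedMartingaleDiff ξ 𝓕 b μ) (n : ℕ) :
    Integrable (fun ω => ∑ i ∈ Finset.range (n + 1), ξ i ω) μ :=
  integrable_finsetSum _ fun i _ => h.integrable i

theorem condExp_sum_succ [IsFiniteMeasure μ] (h : IsBoundedMartingaleDiff ξ 𝓕 b μ) (n : ℕ) :
    μ[fun ω => ∑ i ∈ Finset.range (n + 1 + 1), ξ i ω|𝓕 n] =ᵐ[μ]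
      fun ω => ∑ i ∈ Finset.range (n + 1), ξ i ω := by
  have h1 : (fun ω => ∑ i ∈ Finset.range (n + 1 + 1), ξ i ω) =
      (fun ω => ∑ i ∈ Finset.range (n + 1), ξ i ω) + ξ (n + 1) := by
    ext ω; simp [Finset.sum_range_succ]
  rw [h1]
  refine (condExp_add (h.integrable_sum n) (h.integrable (n + 1)) (𝓕 n)).trans ?_
  rw [condExp_of_stronglyMeasurable (𝓕.le n) (h.stronglyMeasurable_sum n) (h.integrable_sum n)]
  filter_upwards [h.condExp n] with ω hω
  simp [hω]

/-- A continuous convex function of the partial sums is a submartingale. -/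
theorem submartingale_comp [IsFiniteMeasure μ] (h : IsBoundedMartingaleDiff ξ 𝓕 b μ)
    {φ : E → ℝ} (hφ : ConvexOn ℝ Set.univ φ) (hφc : Continuous φ)
    (hφi : ∀ n, Integrable (fun ω => φ (∑ i ∈ Finset.range (n + 1), ξ i ω)) μ) :
    Submartingale (fun n ω => φ (∑ i ∈ Finset.range (n + 1), ξ i ω)) 𝓕 μ := by
  refine submartingale_nat (fun n => hφc.comp_stronglyMeasurable (h.stronglyMeasurable_sum n))
    hφi fun n => ?_
  have hJ := hφ.map_condExp_le_univ (𝓕.le n) hφc.lowerSemicontinuous (h.integrable_sum (n + 1))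
    (hφi (n + 1))
  filter_upwards [hJ, h.condExp_sum_succ n] with ω h1 h2
  simp only [Function.comp_apply, h2] at h1
  exact h1

theorem const_smul (h : IsBoundedMartingaleDiff ξ 𝓕 b μ) {c : ℝ} (hc : 0 ≤ c) :
    IsBoundedMartingaleDiff (fun i ω => c • ξ i ω) 𝓕 (c * b) μ where
  adapted i := (h.adapted i).const_smul c
  bound i ω := by
    rw [norm_smul, Real.norm_of_nonneg hc]
    exact mul_le_mul_of_nonneg_left (h.bound i ω) hc
  condExp i := by
    refine (condExp_smul c (ξ (i + 1)) (𝓕 i)).trans ?_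
    filter_upwards [h.condExp i] with ω hω
    simp [hω]
  integral_zero := by rw [integral_smul, h.integral_zero, smul_zero]

end Banach

end IsBoundedMartingaleDiff

/-! ### Exponential moments of Hilbert-valued sums through `cosh`. -/

/-- The power series `∑ x ^ n / (2n)!` has nonnegative coefficients, so it is a sum of convex
functions on the half-line. -/
theorem convexOn_cosh_sqrt : ConvexOn ℝ (Set.Ici 0) fun x : ℝ => Real.cosh √x := by
  have hs : ∀ x : ℝ, 0 ≤ x →
      HasSum (fun n : ℕ => x ^ n / ((2 * n).factorial : ℝ)) (Real.cosh √x) := by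
    intro x hx
    have := Real.hasSum_cosh √x
    simpa [pow_mul, Real.sq_sqrt hx] using this
  refine ⟨convex_Ici 0, fun x hx y hy a b ha hb hab => ?_⟩
  have hxy : 0 ≤ a • x + b • y := by
    have := Set.mem_Ici.1 hx; have := Set.mem_Ici.1 hy
    simp only [smul_eq_mul]; positivity
  refine hasSum_le (fun n => ?_) (hs _ hxy) (((hs x hx).mul_left a).add ((hs y hy).mul_left b))
  have := (convexOn_pow (𝕜 := ℝ) n).2 hx hy ha hb hab
  simp only [smul_eq_mul] at this ⊢
  calc (a * x + b * y) ^ n / ((2 * n).factorial : ℝ)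
      ≤ (a * x ^ n + b * y ^ n) / ((2 * n).factorial : ℝ) := by gcongr
    _ = _ := by ring

/-- One step of Pinelis' argument: the inner product is linear in `x` and vanishes in conditional
expectation, leaving only the factor `cosh b`. The square `‖v + x‖ ^ 2` lies below a convex
combination of `(‖v‖ - b) ^ 2` and `(‖v‖ + b) ^ 2`, to which convexity of `cosh √·` applies. -/
theorem cosh_norm_add_le [InnerProductSpace ℝ E] (v x : E) {b : ℝ} (hx : ‖x‖ ≤ b) :
    Real.cosh ‖v + x‖ ≤ Real.cosh b * Real.cosh ‖v‖ +
      inner ℝ ((Real.sinh ‖v‖ * Real.sinh b / (‖v‖ * b)) • v) x := by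
  have hb : 0 ≤ b := (norm_nonneg x).trans hx
  have hv : 0 ≤ ‖v‖ := norm_nonneg v
  -- The degenerate cases `v = 0` and `b = 0` are separated because `θ` below divides by `‖v‖ * b`;
  -- there the division by zero makes the coefficient `0`.
  rcases hv.eq_or_lt with hv0 | hv0
  · have : v = 0 := norm_eq_zero.1 hv0.symm
    subst this
    simpa [abs_of_nonneg hb] using hx
  rcases hb.eq_or_lt with hb0 | hb0
  · have : x = 0 := norm_le_zero_iff.1 (hb0 ▸ hx)
    subst this
    simp [← hb0]
  set a := ‖v‖ with ha
  set c : ℝ := inner ℝ v x with hc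
  have hcab : |c| ≤ a * b := (abs_real_inner_le_norm v x).trans (by gcongr)
  have hab : 0 < a * b := mul_pos hv0 hb0
  set θ : ℝ := c / (a * b) with hθ
  have hθab : c = θ * (a * b) := by rw [hθ]; field_simp
  have hθ1 : |θ| ≤ 1 := by
    rw [hθ, abs_div, abs_of_pos hab, div_le_one hab]; exact hcab
  obtain ⟨hθl, hθu⟩ := abs_le.1 hθ1
  have hsq : ‖v + x‖ ^ 2 ≤ ((1 - θ) / 2) • (a - b) ^ 2 + ((1 + θ) / 2) • (a + b) ^ 2 := by
    have h1 : ‖v + x‖ ^ 2 = a ^ 2 + 2 * c + ‖x‖ ^ 2 := norm_add_sq_real v x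
    have h2 : ‖x‖ ^ 2 ≤ b ^ 2 := by gcongr
    simp only [smul_eq_mul]
    rw [h1, hθab]
    nlinarith
  have hmain := convexOn_cosh_sqrt.2 (Set.mem_Ici.2 (sq_nonneg (a - b)))
    (Set.mem_Ici.2 (sq_nonneg (a + b))) (show 0 ≤ (1 - θ) / 2 by linarith)
    (show 0 ≤ (1 + θ) / 2 by linarith) (by ring)
  have hle : Real.cosh ‖v + x‖ ≤
      Real.cosh √(((1 - θ) / 2) • (a - b) ^ 2 + ((1 + θ) / 2) • (a + b) ^ 2) := by
    rw [Real.cosh_le_cosh, abs_of_nonneg (norm_nonneg _), abs_of_nonneg (Real.sqrt_nonneg _)]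
    exact Real.le_sqrt_of_sq_le hsq
  refine (hle.trans hmain).trans (le_of_eq ?_)
  simp only [Real.sqrt_sq_eq_abs, Real.cosh_abs, smul_eq_mul, inner_smul_left, ← hc]
  rw [Real.cosh_sub, Real.cosh_add, hθ]
  simp only [conj_trivial]
  field_simp
  ring

/-- This makes `cosh` of the norm of the partial sums a submartingale, as Doob's inequality
requires. -/
theorem convexOn_cosh_norm [NormedSpace ℝ E] :
    ConvexOn ℝ Set.univ fun v : E => Real.cosh ‖v‖ := by
  refine ⟨convex_univ, fun x _ y _ a b ha hb hab => ?_⟩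
  have h1 : Real.cosh ‖a • x + b • y‖ ≤ Real.cosh (a * ‖x‖ + b * ‖y‖) := by
    rw [Real.cosh_le_cosh, abs_of_nonneg (norm_nonneg _), abs_of_nonneg (by positivity)]
    refine (norm_add_le _ _).trans ?_
    rw [norm_smul, norm_smul, Real.norm_of_nonneg ha, Real.norm_of_nonneg hb]
  refine h1.trans ?_
  have he := convexOn_exp.2 (Set.mem_univ ‖x‖) (Set.mem_univ ‖y‖) ha hb hab
  have he' := convexOn_exp.2 (Set.mem_univ (-‖x‖)) (Set.mem_univ (-‖y‖)) ha hb hab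
  simp only [smul_eq_mul, Real.cosh_eq] at he he' ⊢
  rw [show -(a * ‖x‖ + b * ‖y‖) = a * -‖x‖ + b * -‖y‖ by ring]
  linarith

namespace IsBoundedMartingaleDiff

variable [InnerProductSpace ℝ E] [CompleteSpace E] {ξ : ℕ → Ω → E} {𝓕 : Filtration ℕ m0} {b : ℝ}

theorem integrable_cosh_norm_sum [IsFiniteMeasure μ] (h : IsBoundedMartingaleDiff ξ 𝓕 b μ)
    (n : ℕ) : Integrable (fun ω => Real.cosh ‖∑ i ∈ Finset.range (n + 1), ξ i ω‖) μ := by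
  refine Integrable.of_bound
    ((Real.continuous_cosh.comp continuous_norm).comp_stronglyMeasurable
      ((h.stronglyMeasurable_sum n).mono (𝓕.le n))).aestronglyMeasurable
    (Real.cosh ((n + 1 : ℕ) * b)) (Filter.Eventually.of_forall fun ω => ?_)
  rw [Real.norm_of_nonneg (Real.cosh_pos _).le, Real.cosh_le_cosh,
    abs_of_nonneg (norm_nonneg _)]
  exact (h.norm_sum_le (n + 1) ω).trans (le_abs_self _)

/-- The inner product of an increment with a bounded function of the past has mean zero. -/
theorem integral_inner_eq_zero [IsFiniteMeasure μ] (h : IsBoundedMartingaleDiff ξ 𝓕 b μ) (n : ℕ)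
    {u : Ω → E} (hu : StronglyMeasurable[𝓕 n] u) {c : ℝ} (hc : ∀ ω, ‖u ω‖ ≤ c) :
    Integrable (fun ω => inner ℝ (u ω) (ξ (n + 1) ω)) μ ∧
      ∫ ω, inner ℝ (u ω) (ξ (n + 1) ω) ∂μ = 0 := by
  have hint : Integrable (fun ω => inner ℝ (u ω) (ξ (n + 1) ω)) μ := by
    refine Integrable.of_bound (((hu.mono (𝓕.le n)).inner
      ((h.adapted (n + 1)).mono (𝓕.le (n + 1)))).aestronglyMeasurable) (c * b)
      (Filter.Eventually.of_forall fun ω => ?_)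
    refine (norm_inner_le_norm _ _).trans ?_
    exact mul_le_mul (hc ω) (h.bound (n + 1) ω) (norm_nonneg _) ((norm_nonneg _).trans (hc ω))
  refine ⟨hint, ?_⟩
  have hpull := condExp_bilin_of_stronglyMeasurable_left (m := 𝓕 n) (μ := μ) (innerSL ℝ (E := E)) hu
    (g := ξ (n + 1)) hint (h.integrable (n + 1))
  rw [← integral_condExp (𝓕.le n)]
  refine integral_eq_zero_of_ae ?_
  filter_upwards [hpull, h.condExp n] with ω h1 h2
  refine h1.trans ?_
  rw [h2]
  simp

theorem integral_cosh_norm_sum_le [IsProbabilityMeasure μ]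
    (h : IsBoundedMartingaleDiff ξ 𝓕 b μ) (n : ℕ) :
    ∫ ω, Real.cosh ‖∑ i ∈ Finset.range (n + 1), ξ i ω‖ ∂μ ≤ Real.cosh b ^ (n + 1) := by
  induction n with
  -- The first increment has no past; its norm bound alone gives the factor `cosh b`.
  | zero =>
    have hb : ∀ ω, Real.cosh ‖∑ i ∈ Finset.range (0 + 1), ξ i ω‖ ≤ Real.cosh b ^ (0 + 1) := by
      intro ω
      have := h.bound 0 ω
      simp only [zero_add, Finset.sum_range_one, pow_one]
      rw [Real.cosh_le_cosh, abs_of_nonneg (norm_nonneg _)]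
      exact this.trans (le_abs_self _)
    calc _ ≤ ∫ _, Real.cosh b ^ (0 + 1) ∂μ :=
          integral_mono (h.integrable_cosh_norm_sum 0) (integrable_const _) hb
      _ = _ := by simp
  | succ n ih =>
    set S : Ω → E := fun ω => ∑ i ∈ Finset.range (n + 1), ξ i ω with hS
    have hSm : StronglyMeasurable[𝓕 n] S := h.stronglyMeasurable_sum n
    set w : E → ℝ := fun v => Real.sinh ‖v‖ * Real.sinh b / (‖v‖ * b) with hw
    have hwm : StronglyMeasurable[𝓕 n] fun ω => w (S ω) • S ω := by
      refine StronglyMeasurable.smul ?_ hSm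
      have hn : Measurable[𝓕 n] fun ω => ‖S ω‖ := hSm.norm.measurable
      exact Measurable.stronglyMeasurable
        (((Real.measurable_sinh.comp hn).mul_const _).div (hn.mul_const _))
    -- The factor `‖S ω‖` in the denominator of `w` cancels against the norm of `S ω`, so the vector
    -- paired with the increment is bounded.
    have hwb : ∀ ω, ‖w (S ω) • S ω‖ ≤ Real.sinh ((n + 1 : ℕ) * b) * |Real.sinh b / b| := by
      intro ω
      have hSb : ‖S ω‖ ≤ (n + 1 : ℕ) * b := h.norm_sum_le (n + 1) ω
      rw [norm_smul, hw]
      have hsb : Real.sinh ‖S ω‖ ≤ Real.sinh ((n + 1 : ℕ) * b) := Real.sinh_le_sinh.2 hSb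
      have hs0 : 0 ≤ Real.sinh ‖S ω‖ := Real.sinh_nonneg_iff.2 (norm_nonneg _)
      rcases (norm_nonneg (S ω)).eq_or_lt with h0 | h0
      · rw [← h0] at hs0 hsb ⊢
        rw [mul_zero]
        exact mul_nonneg (hs0.trans hsb) (abs_nonneg _)
      · have : ‖Real.sinh ‖S ω‖ * Real.sinh b / (‖S ω‖ * b)‖ * ‖S ω‖ =
            Real.sinh ‖S ω‖ * |Real.sinh b / b| := by
          rw [mul_div_mul_comm, norm_mul, Real.norm_eq_abs, Real.norm_eq_abs,
            abs_of_nonneg (div_nonneg hs0 h0.le)]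
          field_simp
        simp only [this]
        gcongr
    obtain ⟨hint, hzero⟩ := h.integral_inner_eq_zero n hwm hwb
    have hstep : ∀ ω, Real.cosh ‖∑ i ∈ Finset.range (n + 1 + 1), ξ i ω‖ ≤
        Real.cosh b * Real.cosh ‖S ω‖ + inner ℝ (w (S ω) • S ω) (ξ (n + 1) ω) := by
      intro ω
      rw [Finset.sum_range_succ]
      exact cosh_norm_add_le _ _ (h.bound (n + 1) ω)
    have hint' : Integrable (fun ω => Real.cosh b * Real.cosh ‖S ω‖) μ :=
      (h.integrable_cosh_norm_sum n).const_mul _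
    calc _ ≤ ∫ ω, (Real.cosh b * Real.cosh ‖S ω‖ +
            inner ℝ (w (S ω) • S ω) (ξ (n + 1) ω)) ∂μ :=
          integral_mono (h.integrable_cosh_norm_sum (n + 1)) (hint'.add hint) hstep
      _ = Real.cosh b * ∫ ω, Real.cosh ‖S ω‖ ∂μ := by
          rw [integral_add hint' hint, hzero, add_zero, integral_const_mul]
      _ ≤ Real.cosh b * Real.cosh b ^ (n + 1) :=
          mul_le_mul_of_nonneg_left ih (Real.cosh_pos _).le
      _ = _ := by ring

/-- A sub-Gaussian maximal inequality for bounded martingale differences in a Hilbert space. -/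
theorem measure_exists_le_norm_sum_le [IsProbabilityMeasure μ]
    (h : IsBoundedMartingaleDiff ξ 𝓕 b μ) (hb : 0 < b) {r : ℝ} (hr : 0 ≤ r) (n : ℕ) :
    μ {ω | ∃ k ≤ n, r ≤ ‖∑ i ∈ Finset.range (k + 1), ξ i ω‖} ≤
      ENNReal.ofReal (2 * Real.exp (-(r ^ 2 / (2 * b ^ 2 * (n + 1))))) := by
  -- This scale minimises the exponent `(n + 1) (c b)² / 2 - c r`.
  set c : ℝ := r / (b ^ 2 * (n + 1)) with hc
  have hc0 : 0 ≤ c := by positivity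
  have hS : ∀ k ω, ∑ i ∈ Finset.range (k + 1), c • ξ i ω =
      c • ∑ i ∈ Finset.range (k + 1), ξ i ω := fun k ω => Finset.smul_sum.symm
  have h' := h.const_smul hc0
  have hsub := h'.submartingale_comp convexOn_cosh_norm
    (Real.continuous_cosh.comp continuous_norm) h'.integrable_cosh_norm_sum
  have hmax := Submartingale.measure_exists_le_le hsub (fun n ω => (Real.cosh_pos _).le)
    (Real.cosh_pos (c * r)) n
  refine (measure_mono ?_).trans (hmax.trans (ENNReal.ofReal_le_ofReal ?_))
  · rintro ω ⟨k, hk, hkr⟩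
    refine ⟨k, hk, ?_⟩
    rw [hS, Real.cosh_le_cosh, abs_of_nonneg (by positivity), abs_of_nonneg (norm_nonneg _),
      norm_smul, Real.norm_of_nonneg hc0]
    gcongr
  -- Bounding `cosh` below by half an exponential is the source of the prefactor `2`.
  · have h1 : Real.exp (c * r) / 2 ≤ Real.cosh (c * r) := by
      rw [Real.cosh_eq]; linarith [Real.exp_pos (-(c * r))]
    have h2 : Real.cosh (c * b) ^ (n + 1) ≤ Real.exp ((c * b) ^ 2 / 2) ^ (n + 1) :=
      pow_le_pow_left₀ (Real.cosh_pos _).le (Real.cosh_le_exp_half_sq _) _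
    calc _ ≤ Real.exp ((c * b) ^ 2 / 2) ^ (n + 1) / (Real.exp (c * r) / 2) :=
          div_le_div₀ (by positivity) ((h'.integral_cosh_norm_sum_le n).trans h2)
            (by positivity) h1
      _ = 2 * Real.exp ((n + 1 : ℕ) * ((c * b) ^ 2 / 2) - c * r) := by
          rw [← Real.exp_nat_mul, Real.exp_sub]; field_simp
      _ = _ := by
          congr 2
          rw [hc]; push_cast; field_simp; ring

end IsBoundedMartingaleDiff

/-- A sub-Gaussian maximal inequality for sums of bounded independent centred real variables. -/
theorem IsBoundedMartingaleDiff.measure_exists_le_sum_le [IsProbabilityMeasure μ]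
    {ξ : ℕ → Ω → ℝ} {𝓕 : Filtration ℕ m0} {b : ℝ} (h : IsBoundedMartingaleDiff ξ 𝓕 b μ)
    (hind : iIndepFun ξ μ) {v : NNReal} (hv : 0 < v) (hsg : ∀ i, HasSubgaussianMGF (ξ i) v μ)
    {r : ℝ} (hr : 0 ≤ r) (n : ℕ) :
    μ {ω | ∃ k ≤ n, r ≤ ∑ i ∈ Finset.range (k + 1), ξ i ω} ≤
      ENNReal.ofReal (Real.exp (-(r ^ 2 / (2 * v * (n + 1))))) := by
  have hv' : (0 : ℝ) < v := hv
  set c : ℝ := r / (v * (n + 1)) with hc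
  have hc0 : 0 ≤ c := by positivity
  have hsum : ∀ k, HasSubgaussianMGF (fun ω => ∑ i ∈ Finset.range (k + 1), ξ i ω)
      (∑ _i ∈ Finset.range (k + 1), v) μ := fun k =>
    HasSubgaussianMGF.sum_of_iIndepFun hind fun i _ => hsg i
  have hconv : ConvexOn ℝ Set.univ fun x : ℝ => Real.exp (c * x) :=
    convexOn_exp.comp_linearMap (LinearMap.mulLeft ℝ c)
  have hsub := h.submartingale_comp hconv (by fun_prop) fun k => (hsum k).integrable_exp_mul c
  have hmax := Submartingale.measure_exists_le_le hsub (fun n ω => (Real.exp_pos _).le)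
    (Real.exp_pos (c * r)) n
  refine (measure_mono ?_).trans (hmax.trans (ENNReal.ofReal_le_ofReal ?_))
  · rintro ω ⟨k, hk, hkr⟩
    exact ⟨k, hk, Real.exp_le_exp.2 (mul_le_mul_of_nonneg_left hkr hc0)⟩
  · have hm := (hsum n).mgf_le c
    rw [mgf] at hm
    calc _ ≤ Real.exp ((∑ _i ∈ Finset.range (n + 1), v : NNReal) * c ^ 2 / 2) /
            Real.exp (c * r) := by gcongr
      _ = _ := by
          rw [← Real.exp_sub]
          congr 1
          simp only [Finset.sum_const, Finset.card_range, nsmul_eq_mul]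
          rw [hc]; push_cast; field_simp; ring

end Maximal

/-! ### Mean embeddings -/

noncomputable section MeanEmbedding

/-- The feature map `x ↦ K(·, x)` of a scalar reproducing kernel Hilbert space. -/
def rkhsFeature {X : Type*} (H : Type*) [NormedAddCommGroup H] [InnerProductSpace ℝ H]
    [CompleteSpace H] [RKHS ℝ H X ℝ] (x : X) : H :=
  RKHS.kerFun H x (1 : ℝ)

/-- The mean embedding `∫ K(·, x) dP(x)` of a measure. -/
def meanEmbedding {X : Type*} [MeasurableSpace X] (H : Type*) [NormedAddCommGroup H]
    [InnerProductSpace ℝ H] [CompleteSpace H] [RKHS ℝ H X ℝ] (P : Measure X) : H :=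
  ∫ x, rkhsFeature H x ∂P

theorem exists_norm_le_one_inner_eq_norm {H : Type*}
    [NormedAddCommGroup H] [InnerProductSpace ℝ H] (v : H) : ∃ f : H, ‖f‖ ≤ 1 ∧ inner ℝ f v = ‖v‖ := by
  rcases eq_or_ne v 0 with rfl | hv
  · exact ⟨0, by simp, by simp⟩
  · have hv' : ‖v‖ ≠ 0 := norm_ne_zero_iff.2 hv
    refine ⟨‖v‖⁻¹ • v, by simp [norm_smul, hv'], ?_⟩
    rw [real_inner_smul_left, real_inner_self_eq_norm_sq]
    field_simp

section Generic

variable {X : Type*} {H : Type*} [NormedAddCommGroup H] [InnerProductSpace ℝ H]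
  [CompleteSpace H] [RKHS ℝ H X ℝ]

theorem inner_rkhsFeature (f : H) (x : X) : inner ℝ f (rkhsFeature H x) = f x := by
  simp [rkhsFeature]

theorem inner_rkhsFeature_rkhsFeature {K : X → X → ℝ} (hker : RKHS.kernel H = kernelMatrix K)
    (x y : X) : inner ℝ (rkhsFeature H x) (rkhsFeature H y) = K y x := by
  rw [inner_rkhsFeature, rkhsFeature, RKHS.kerFun_apply, hker]
  simp [kernelMatrix]

theorem norm_sq_rkhsFeature_sub {K : X → X → ℝ} (hker : RKHS.kernel H = kernelMatrix K)
    (hsymm : ∀ x y, K x y = K y x) (x y : X) :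
    ‖rkhsFeature H x - rkhsFeature H y‖ ^ 2 = K x x + K y y - 2 * K x y := by
  rw [@norm_sub_sq_real, inner_rkhsFeature_rkhsFeature hker, ← real_inner_self_eq_norm_sq,
    ← real_inner_self_eq_norm_sq, inner_rkhsFeature_rkhsFeature hker,
    inner_rkhsFeature_rkhsFeature hker, hsymm y x]
  ring

theorem norm_rkhsFeature_le {K : X → X → ℝ} {B : ℝ} (hker : RKHS.kernel H = kernelMatrix K) (hB : ∀ x y, K x y ≤ B)
    (x : X) : ‖rkhsFeature H x‖ ≤ √B := by
  refine Real.le_sqrt_of_sq_le ?_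
  rw [← real_inner_self_eq_norm_sq, inner_rkhsFeature_rkhsFeature hker]
  exact hB x x

theorem integral_coe_eq_inner_meanEmbedding [MeasurableSpace X] {P : Measure X}
    (hP : Integrable (rkhsFeature H : X → H) P) (f : H) :
    ∫ x, f x ∂P = inner ℝ f (meanEmbedding H P) := by
  simp_rw [← inner_rkhsFeature]
  exact integral_inner hP f

/-- The integral probability metric of the unit ball of a reproducing kernel Hilbert space is the
distance between the mean embeddings. -/
theorem ipm_rkhsUnitBall [MeasurableSpace X] {P Q : Measure X} (hP : Integrable (rkhsFeature H : X → H) P)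
    (hQ : Integrable (rkhsFeature H : X → H) Q) :
    ipm (rkhsUnitBall H) P Q = ‖meanEmbedding H P - meanEmbedding H Q‖ := by
  have hval : ∀ f : H, (∫ x, f x ∂P) - ∫ x, f x ∂Q =
      inner ℝ f (meanEmbedding H P - meanEmbedding H Q) := fun f => by
    rw [integral_coe_eq_inner_meanEmbedding hP, integral_coe_eq_inner_meanEmbedding hQ,
      inner_sub_right]
  -- The supremum is attained, at the normalised difference of the embeddings.
  refine IsGreatest.csSup_eq ⟨?_, ?_⟩
  · obtain ⟨f, hf1, hf⟩ :=
      exists_norm_le_one_inner_eq_norm (meanEmbedding H P - meanEmbedding H Q)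
    exact ⟨f, ⟨f, hf1, rfl⟩, (hval f).trans hf⟩
  · rintro _ ⟨_, ⟨f, hf1, rfl⟩, rfl⟩
    refine (hval f).le.trans ((real_inner_le_norm _ _).trans ?_)
    exact mul_le_of_le_one_left (norm_nonneg _) hf1

variable [TopologicalSpace X] {K : X → X → ℝ} {B : ℝ}

/-- Continuity on a second countable space gives strong measurability of the feature map, with no
separability assumption on `H`. -/
theorem IsMercerKernel.continuous_rkhsFeature (hK : IsMercerKernel K)
    (hker : RKHS.kernel H = kernelMatrix K) : Continuous (rkhsFeature H : X → H) := by
  rw [continuous_iff_continuousAt]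
  intro x
  rw [ContinuousAt, tendsto_iff_norm_sub_tendsto_zero]
  have hc : Continuous fun y => √(K y y + K x x - 2 * K y x) := by
    have h1 : Continuous fun y => K y y := hK.continuous.comp (continuous_id.prodMk continuous_id)
    have h2 : Continuous fun y => K y x :=
      hK.continuous.comp (continuous_id.prodMk continuous_const)
    exact ((h1.add continuous_const).sub (continuous_const.mul h2)).sqrt
  have h := hc.tendsto x
  rw [show K x x + K x x - 2 * K x x = 0 by ring, Real.sqrt_zero] at h
  refine h.congr fun y => ?_
  rw [← norm_sq_rkhsFeature_sub hker hK.symm, Real.sqrt_sq (norm_nonneg _)]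

/-- Nonnegativity of `K` discards the cross term, which yields `2B` instead of the `4B` given by the
triangle inequality. -/
theorem IsMercerKernel.norm_rkhsFeature_sub_le (hK : IsMercerKernel K)
    (hker : RKHS.kernel H = kernelMatrix K) (hB : ∀ x y, K x y ≤ B) (x y : X) :
    ‖rkhsFeature H x - rkhsFeature H y‖ ≤ √(2 * B) := by
  refine Real.le_sqrt_of_sq_le ?_
  rw [norm_sq_rkhsFeature_sub hker hK.symm]
  linarith [hB x x, hB y y, hK.nonneg x y]

variable [MeasurableSpace X] [BorelSpace X] [SecondCountableTopology X]

theorem IsMercerKernel.integrable_rkhsFeature (hK : IsMercerKernel K)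
    (hker : RKHS.kernel H = kernelMatrix K) (hB : ∀ x y, K x y ≤ B) (P : Measure X)
    [IsFiniteMeasure P] : Integrable (rkhsFeature H : X → H) P :=
  Integrable.of_bound (hK.continuous_rkhsFeature hker).stronglyMeasurable.aestronglyMeasurable
    (√B) (Filter.Eventually.of_forall (norm_rkhsFeature_le hker hB))

/-- Centring averages the differences of features, so it keeps their bound. -/
theorem IsMercerKernel.norm_rkhsFeature_sub_meanEmbedding_le (hK : IsMercerKernel K)
    (hker : RKHS.kernel H = kernelMatrix K) (hB : ∀ x y, K x y ≤ B) (P : Measure X)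
    [IsProbabilityMeasure P] (x : X) : ‖rkhsFeature H x - meanEmbedding H P‖ ≤ √(2 * B) := by
  have h : rkhsFeature H x - meanEmbedding H P =
      ∫ y, (rkhsFeature H x - rkhsFeature H y) ∂P := by
    rw [integral_sub (integrable_const _) (hK.integrable_rkhsFeature hker hB P)]
    simp [meanEmbedding]
  rw [h]
  have := norm_integral_le_of_norm_le_const (μ := P) (Filter.Eventually.of_forall fun y =>
    hK.norm_rkhsFeature_sub_le hker hB x y)
  simpa using this

end Generic

instance isProbabilityMeasure_empMeasure {Ω X : Type*} [MeasurableSpace X] (Z : ℕ → Ω → X)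
    (t : ℕ) [NeZero t] (ω : Ω) : IsProbabilityMeasure (empMeasure Z t ω) := by
  constructor
  simp [empMeasure, ENNReal.inv_mul_cancel, NeZero.ne]

theorem integral_empMeasure {Ω X E : Type*} [MeasurableSpace X] [MeasurableSingletonClass X]
    [NormedAddCommGroup E] [NormedSpace ℝ E] [CompleteSpace E] (Z : ℕ → Ω → X) (t : ℕ) (ω : Ω)
    (f : X → E) : ∫ x, f x ∂(empMeasure Z t ω) =
      (t : ℝ)⁻¹ • ∑ i ∈ Finset.range t, f (Z i ω) := by
  rw [empMeasure, integral_smul_measure, integral_finsetSum_measure]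
  · simp
  · intro i _
    exact (integrable_dirac (by simp))

end MeanEmbedding

/-! ### Time-uniform bounds for one sample -/

section OneSample

variable {Ω : Type*} [MeasurableSpace Ω] {μ : Measure Ω} {d : ℕ} {P : Measure (Eucl d)}
  {Z : ℕ → Ω → Eucl d}

theorem IsIIDSample.integral_comp {E : Type*} [NormedAddCommGroup E] [NormedSpace ℝ E]
    (hZ : IsIIDSample Z P μ) {φ : Eucl d → E} (hφ : StronglyMeasurable φ) (i : ℕ) :
    ∫ ω, φ (Z i ω) ∂μ = ∫ x, φ x ∂P := by
  rw [← hZ.law i, integral_map (hZ.measurable i).aemeasurable hφ.aestronglyMeasurable]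

theorem IsIIDSample.isBoundedMartingaleDiff [IsProbabilityMeasure μ] {E : Type*}
    [NormedAddCommGroup E] [NormedSpace ℝ E] [CompleteSpace E] (hZ : IsIIDSample Z P μ)
    {φ : Eucl d → E} (hφ : StronglyMeasurable φ) {b : ℝ} (hb : ∀ x, ‖φ x‖ ≤ b)
    (h0 : ∫ x, φ x ∂P = 0) :
    IsBoundedMartingaleDiff (fun i ω => φ (Z i ω))
      (Filtration.natural Z fun i => (hZ.measurable i).stronglyMeasurable) b μ where
  adapted i := hφ.comp_measurable ((Filtration.stronglyAdapted_natural
    fun i => (hZ.measurable i).stronglyMeasurable) i).measurable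
  bound i ω := hb _
  condExp i := by
    have h := condExp_indep_eq (μ := μ) (hZ.measurable (i + 1)).comap_le
      ((Filtration.natural Z fun i => (hZ.measurable i).stronglyMeasurable).le i)
      (f := fun ω => φ (Z (i + 1) ω)) (hφ.comp_measurable (comap_measurable (Z (i + 1))))
      (hZ.indep.indep_comap_natural_of_lt
        (fun i => (hZ.measurable i).stronglyMeasurable) (Nat.lt_succ_self i))
    refine h.trans (Filter.Eventually.of_forall fun ω => ?_)
    exact (hZ.integral_comp hφ (i + 1)).trans h0
  integral_zero := (hZ.integral_comp hφ 0).trans h0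

/-- A union bound over the dyadic epochs `[2 ^ k, 2 ^ (k + 1))`. -/
theorem measure_exists_one_le_le_of_dyadic {p : ℕ → Ω → Prop} {c : ℕ → ℝ} {C : ℝ}
    (hc0 : ∀ k, 0 ≤ c k) (hcs : Summable c) (hcC : ∑' k, c k ≤ C)
    (h : ∀ k, μ {ω | ∃ t, 2 ^ k ≤ t ∧ t < 2 ^ (k + 1) ∧ p t ω} ≤ ENNReal.ofReal (c k)) :
    μ {ω | ∃ t, 1 ≤ t ∧ p t ω} ≤ ENNReal.ofReal C := by
  calc μ {ω | ∃ t, 1 ≤ t ∧ p t ω}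
      ≤ μ (⋃ k, {ω | ∃ t, 2 ^ k ≤ t ∧ t < 2 ^ (k + 1) ∧ p t ω}) := by
        refine measure_mono ?_
        rintro ω ⟨t, ht, hp⟩
        exact Set.mem_iUnion.2 ⟨Nat.log 2 t, t, Nat.pow_log_le_self 2 (by omega),
          Nat.lt_pow_succ_log_self one_lt_two t, hp⟩
    _ ≤ ∑' k, ENNReal.ofReal (c k) := (measure_iUnion_le _).trans (ENNReal.tsum_le_tsum h)
    _ ≤ ENNReal.ofReal C := by
        rw [← ENNReal.ofReal_tsum_of_nonneg hc0 hcs]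
        exact ENNReal.ofReal_le_ofReal hcC

/-- A union bound over the dyadic epochs `[2 ^ (k + 1), 2 ^ (k + 2))`, when time `1` is harmless. -/
theorem measure_exists_one_le_le_of_dyadic_succ {p : ℕ → Ω → Prop} {c : ℕ → ℝ} {C : ℝ}
    (hc0 : ∀ k, 0 ≤ c k) (hcs : Summable c) (hcC : ∑' k, c k ≤ C) (h1 : ∀ ω, ¬p 1 ω)
    (h : ∀ k, μ {ω | ∃ t, 2 ^ (k + 1) ≤ t ∧ t < 2 ^ (k + 1 + 1) ∧ p t ω} ≤
      ENNReal.ofReal (c k)) :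
    μ {ω | ∃ t, 1 ≤ t ∧ p t ω} ≤ ENNReal.ofReal C := by
  calc μ {ω | ∃ t, 1 ≤ t ∧ p t ω}
      ≤ μ (⋃ k, {ω | ∃ t, 2 ^ (k + 1) ≤ t ∧ t < 2 ^ (k + 1 + 1) ∧ p t ω}) := by
        refine measure_mono ?_
        rintro ω ⟨t, ht, hp⟩
        have ht1 : t ≠ 1 := by rintro rfl; exact h1 ω hp
        have hlog : 0 < Nat.log 2 t := Nat.log_pos one_lt_two (by omega)
        refine Set.mem_iUnion.2 ⟨Nat.log 2 t - 1, t, ?_, ?_, hp⟩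
        · rw [Nat.sub_add_cancel hlog]
          exact Nat.pow_log_le_self 2 (by omega)
        · rw [Nat.sub_add_cancel hlog]
          exact Nat.lt_pow_succ_log_self one_lt_two t
    _ ≤ ∑' k, ENNReal.ofReal (c k) := (measure_iUnion_le _).trans (ENNReal.tsum_le_tsum h)
    _ ≤ ENNReal.ofReal C := by
        rw [← ENNReal.ofReal_tsum_of_nonneg hc0 hcs]
        exact ENNReal.ofReal_le_ofReal hcC

/-! ### Consequences of the stitching conditions. -/

theorem le_logb_two_of_pow_le {k t : ℕ} (h : 2 ^ k ≤ t) : (k : ℝ) ≤ Real.logb 2 t := by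
  have ht : 0 < t := lt_of_lt_of_le (by positivity) h
  rw [Real.le_logb_iff_rpow_le one_lt_two (by exact_mod_cast ht), Real.rpow_natCast]
  exact_mod_cast h

/-- The first term of the double series gives `e ≤ g 2`; constancy on `[0, 2]` and monotonicity
spread it. -/
theorem IsStitchingTwo.exp_one_le {g : ℝ → ℝ} (hg : IsStitchingTwo g) {x : ℝ} (hx : 0 ≤ x) :
    Real.exp 1 ≤ g x := by
  have h2 : Real.exp 1 ≤ g 2 := by
    have h := (hg.summable.le_tsum (0, 0) fun p _ => div_nonneg (Real.exp_pos 1).le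
      (zero_le_one.trans (hg.one_le _ (by positivity)))).trans hg.tsum_le
    norm_num at h
    rwa [div_le_one (zero_lt_one.trans_le (hg.one_le 2 (by norm_num)))] at h
  rcases le_total x 2 with h | h
  · rwa [hg.const x ⟨hx, h⟩]
  · exact h2.trans (hg.mono (Set.mem_Ici.2 zero_le_two) (Set.mem_Ici.2 hx) h)

/-- One row of the double series bounds the tail from `k = 2` by `1 / e`; the terms at `0` and `1`
add at most `1 / e` each. -/
theorem IsStitchingTwo.summable_inv_and_tsum_inv_le {g : ℝ → ℝ} (hg : IsStitchingTwo g) :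
    (Summable fun k : ℕ => 1 / g k) ∧ ∑' k : ℕ, 1 / g k ≤ 3 / Real.exp 1 := by
  have he : 0 < Real.exp 1 := Real.exp_pos 1
  have hinj : Function.Injective fun k : ℕ => (k, 0) := fun a b h => (Prod.mk.inj h).1
  have hs := hg.summable.comp_injective hinj
  have hle := (tsum_comp_le_tsum_of_inj hg.summable (fun p => div_nonneg he.le
    (zero_le_one.trans (hg.one_le _ (by positivity)))) hinj).trans hg.tsum_le
  have hfun : ((fun p : ℕ × ℕ => Real.exp 1 / g (((p.1 : ℝ) + 1) + ((p.2 : ℝ) + 1))) ∘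
      fun k : ℕ => (k, 0)) = fun k : ℕ => Real.exp 1 * (1 / g ((k + 2 : ℕ) : ℝ)) := by
    ext k
    have : ((k : ℝ) + 1) + (((0 : ℕ) : ℝ) + 1) = ((k + 2 : ℕ) : ℝ) := by push_cast; ring
    simp only [Function.comp_apply, this]
    ring
  rw [hfun] at hs hle
  rw [tsum_mul_left] at hle
  have hs2 : Summable fun k : ℕ => 1 / g ((k + 2 : ℕ) : ℝ) :=
    (summable_mul_left_iff he.ne').1 hs
  have hs0 := (summable_nat_add_iff (f := fun k : ℕ => 1 / g (k : ℝ)) 2).1 hs2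
  refine ⟨hs0, ?_⟩
  rw [← hs0.sum_add_tsum_nat_add 2]
  have hterm : ∀ x : ℝ, 0 ≤ x → 1 / g x ≤ 1 / Real.exp 1 := fun x hx =>
    one_div_le_one_div_of_le he (hg.exp_one_le hx)
  have h0 := hterm ((0 : ℕ) : ℝ) (by simp)
  have h1 := hterm ((1 : ℕ) : ℝ) (by simp)
  have h3 : ∑' k : ℕ, 1 / g ((k + 2 : ℕ) : ℝ) ≤ 1 / Real.exp 1 := by
    rwa [le_div_iff₀' he]
  rw [Finset.sum_range_succ, Finset.sum_range_one]
  calc _ ≤ 1 / Real.exp 1 + 1 / Real.exp 1 + 1 / Real.exp 1 := by gcongr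
    _ = _ := by ring

variable {H : Type*} [NormedAddCommGroup H] [InnerProductSpace ℝ H] [CompleteSpace H]
  [RKHS ℝ H (Eucl d) ℝ] {K : Eucl d → Eucl d → ℝ} {B : ℝ}

theorem meanEmbedding_empMeasure_sub {Ω : Type*} {Z : ℕ → Ω → Eucl d} (t : ℕ) (ht : 1 ≤ t) (ω : Ω) :
    meanEmbedding H (empMeasure Z t ω) - meanEmbedding H P =
      (t : ℝ)⁻¹ • ∑ i ∈ Finset.range t, (rkhsFeature H (Z i ω) - meanEmbedding H P) := by
  have ht' : (t : ℝ) ≠ 0 := by positivity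
  rw [Finset.sum_sub_distrib, smul_sub]
  congr 1
  · exact integral_empMeasure Z t ω _
  · simp [← Nat.cast_smul_eq_nsmul ℝ, smul_smul, ht']

/-- The one-sample part of the bound `gammaMMD`. -/
noncomputable def gammaOne (g : ℝ → ℝ) (B δ : ℝ) (t : ℕ) : ℝ :=
  2 * √(2 * B) * (t : ℝ) ^ (-(1 / 2) : ℝ) +
    2 * √2 * √(B * (Real.log (g (Real.logb 2 t)) + Real.log (2 / δ)) / t)

theorem rpow_neg_half (t : ℕ) : (t : ℝ) ^ (-(1 / 2) : ℝ) = (√(t : ℝ))⁻¹ := by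
  rw [Real.rpow_neg (by positivity), Real.sqrt_eq_rpow]

theorem gammaOne_nonneg (g : ℝ → ℝ) (B δ : ℝ) (t : ℕ) : 0 ≤ gammaOne g B δ t := by
  unfold gammaOne; positivity

theorem nonneg_of_kernel_le (hK : IsMercerKernel K) (hB : ∀ x y, K x y ≤ B) : 0 ≤ B :=
  (hK.nonneg 0 0).trans (hB 0 0)

/-- On a dyadic epoch, `t * gammaOne` is at least a constant. -/
theorem le_mul_gammaOne {g : ℝ → ℝ} (hg : IsStitchingTwo g) (hB0 : 0 ≤ B) {δ : ℝ} (hδ0 : 0 < δ)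
    (hδ1 : δ < 1) {k t : ℕ} (ht : 2 ^ k ≤ t) :
    2 * √2 * √(B * 2 ^ k) * (1 + √(Real.log (g k) + Real.log (2 / δ))) ≤
      t * gammaOne g B δ t := by
  have ht0 : 0 < t := lt_of_lt_of_le (by positivity) ht
  have ht' : (0 : ℝ) < t := by exact_mod_cast ht0
  have htk : (2 : ℝ) ^ k ≤ t := by exact_mod_cast ht
  have hL : Real.log (g k) ≤ Real.log (g (Real.logb 2 t)) := by
    have hk := le_logb_two_of_pow_le ht
    have hk0 : (0 : ℝ) ≤ k := by positivity
    exact Real.log_le_log (zero_lt_one.trans_le (hg.one_le _ hk0))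
      (hg.mono (Set.mem_Ici.2 hk0) (Set.mem_Ici.2 (hk0.trans hk)) hk)
  set L := Real.log (g k) + Real.log (2 / δ) with hLdef
  set M := Real.log (g (Real.logb 2 t)) + Real.log (2 / δ) with hMdef
  have hLM : L ≤ M := by simp only [hLdef, hMdef]; linarith
  -- In this form the `√t` growth is visible, so the left end `2 ^ k` of the epoch gives the lower
  -- bound.
  have h1 : (t : ℝ) * gammaOne g B δ t = 2 * √2 * (√(B * t) + √(B * t * M)) := by
    unfold gammaOne
    rw [← hMdef, rpow_neg_half]
    have hst : (t : ℝ) = √t * √t := (Real.mul_self_sqrt ht'.le).symm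
    have hst0 : √(t : ℝ) ≠ 0 := (Real.sqrt_pos.2 ht').ne'
    have e1 : (t : ℝ) * √(B * M / t) = √(B * t * M) := by
      have : B * t * M = t ^ 2 * (B * M / t) := by field_simp
      rw [this, Real.sqrt_mul (by positivity), Real.sqrt_sq ht'.le]
    have e2 : (t : ℝ) * (√(t : ℝ))⁻¹ = √t := by
      nth_rewrite 1 [hst]; field_simp
    rw [Real.sqrt_mul zero_le_two, Real.sqrt_mul hB0]
    calc _ = 2 * √2 * √B * (t * (√(t : ℝ))⁻¹) + 2 * √2 * (t * √(B * M / t)) := by ring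
      _ = _ := by rw [e1, e2]; ring
  rw [h1, mul_assoc (2 * √2), mul_add, mul_one, ← Real.sqrt_mul (by positivity)]
  have hL0 : 0 ≤ L := add_nonneg
    (Real.log_nonneg (hg.one_le _ (by positivity)))
    (Real.log_nonneg (by rw [le_div_iff₀ hδ0]; linarith))
  gcongr

theorem log_two_div_nonneg {δ : ℝ} (hδ0 : 0 < δ) (hδ1 : δ < 1) : 0 ≤ Real.log (2 / δ) :=
  Real.log_nonneg (by rw [le_div_iff₀ hδ0]; linarith)

/-- With probability at least `1 - δ / 4`, the empirical mean embedding stays within `gammaOne` of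
the mean embedding at all times. -/
theorem IsIIDSample.measure_exists_gammaOne_lt_le [IsProbabilityMeasure μ]
    [IsProbabilityMeasure P] (hZ : IsIIDSample Z P μ) (hK : IsMercerKernel K)
    (hker : RKHS.kernel H = kernelMatrix K) (hB : ∀ x y, K x y ≤ B) {g : ℝ → ℝ}
    (hg : IsStitchingTwo g) {δ : ℝ} (hδ0 : 0 < δ) (hδ1 : δ < 1) :
    μ {ω | ∃ t, 1 ≤ t ∧ gammaOne g B δ t <
        ‖meanEmbedding H (empMeasure Z t ω) - meanEmbedding H P‖} ≤ ENNReal.ofReal (δ / 4) := by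
  have hB0 := nonneg_of_kernel_le hK hB
  set φ : Eucl d → H := fun x => rkhsFeature H x - meanEmbedding H P with hφ
  have hφm : StronglyMeasurable φ :=
    ((hK.continuous_rkhsFeature hker).sub continuous_const).stronglyMeasurable
  have hφb : ∀ x, ‖φ x‖ ≤ √(2 * B) := hK.norm_rkhsFeature_sub_meanEmbedding_le hker hB P
  have hφ0 : ∫ x, φ x ∂P = 0 := by
    rw [hφ, integral_sub (hK.integrable_rkhsFeature hker hB P) (integrable_const _)]
    simp [meanEmbedding]
  have hdiff := hZ.isBoundedMartingaleDiff hφm hφb hφ0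
  have hnorm : ∀ t, 1 ≤ t → ∀ ω, gammaOne g B δ t <
      ‖meanEmbedding H (empMeasure Z t ω) - meanEmbedding H P‖ →
      t * gammaOne g B δ t < ‖∑ i ∈ Finset.range t, φ (Z i ω)‖ := by
    intro t ht ω h
    have ht' : (0 : ℝ) < t := by exact_mod_cast ht
    rw [meanEmbedding_empMeasure_sub t ht, norm_smul, norm_inv, Real.norm_natCast,
      lt_inv_mul_iff₀ ht'] at h
    exact h
  obtain ⟨hgs, hgt⟩ := hg.summable_inv_and_tsum_inv_le
  refine measure_exists_one_le_le_of_dyadic (c := fun k : ℕ => Real.exp (-3) * δ * (1 / g k))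
    (fun k => ?_) (hgs.mul_left _) ?_ fun k => ?_
  · have := hg.one_le k (by positivity)
    positivity
  · rw [tsum_mul_left]
    -- The total error is `3 e⁻⁴ δ`, and `e ≥ 2` already makes it at most `δ / 4`.
    have h3 : Real.exp (-3) * (3 / Real.exp 1) ≤ 1 / 4 := by
      rw [Real.exp_neg, ← div_eq_inv_mul, div_div, ← Real.exp_add,
        div_le_div_iff₀ (Real.exp_pos _) (by norm_num)]
      have : (2 : ℝ) ^ 4 ≤ Real.exp 1 ^ 4 := by
        gcongr
        exact (by norm_num : (2 : ℝ) ≤ 1 + 1).trans (Real.add_one_le_exp 1)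
      rw [← Real.exp_nat_mul] at this
      norm_num at this ⊢
      linarith
    calc _ ≤ Real.exp (-3) * δ * (3 / Real.exp 1) := by gcongr
      _ = δ * (Real.exp (-3) * (3 / Real.exp 1)) := by ring
      _ ≤ δ * (1 / 4) := by gcongr
      _ = _ := by ring
  -- The maximal inequality needs a positive increment bound; if `B = 0` all sums vanish and the bad
  -- event is empty.
  · rcases hB0.eq_or_lt with hB00 | hBpos
    · refine (measure_mono_null ?_ measure_empty).le.trans zero_le
      rintro ω ⟨t, ht, -, h⟩
      have h' := hnorm t (Nat.one_le_two_pow.trans ht) ω h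
      have hz : ‖∑ i ∈ Finset.range t, φ (Z i ω)‖ ≤ t * √(2 * B) := hdiff.norm_sum_le t ω
      rw [← hB00, mul_zero, Real.sqrt_zero, mul_zero] at hz
      have := mul_nonneg (Nat.cast_nonneg (α := ℝ) t) (gammaOne_nonneg g B δ t)
      linarith
    set L := Real.log (g k) + Real.log (2 / δ) with hL
    have hgk := hg.exp_one_le (x := k) (by positivity)
    have hgk0 : 0 < g k := (Real.exp_pos 1).trans_le hgk
    have hL1 : 1 ≤ L := by
      have h1 : 1 ≤ Real.log (g k) := by rwa [Real.le_log_iff_exp_le hgk0]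
      linarith [log_two_div_nonneg hδ0 hδ1]
    set r := 2 * √2 * √(B * 2 ^ k) * (1 + √L) with hr
    have hr0 : 0 ≤ r := by positivity
    -- Index `n` in the maximal inequality stands for `n + 1` summands, hence the `- 1`.
    have hmain := hdiff.measure_exists_le_norm_sum_le (Real.sqrt_pos.2 (by positivity)) hr0
      (2 ^ (k + 1) - 1)
    refine (measure_mono ?_).trans (hmain.trans (ENNReal.ofReal_le_ofReal ?_))
    · rintro ω ⟨t, ht1, ht2, h⟩
      have ht : 1 ≤ t := Nat.one_le_two_pow.trans ht1
      refine ⟨t - 1, by omega, ?_⟩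
      rw [Nat.sub_add_cancel ht]
      exact (le_mul_gammaOne hg hB0 hδ0 hδ1 ht1).trans (hnorm t ht ω h).le
    · have hcast : ((2 ^ (k + 1) - 1 : ℕ) : ℝ) + 1 = 2 ^ (k + 1) := by
        rw [← Nat.cast_add_one, Nat.sub_add_cancel Nat.one_le_two_pow]; push_cast; rfl
      have hexp : r ^ 2 / (2 * √(2 * B) ^ 2 * (((2 ^ (k + 1) - 1 : ℕ) : ℝ) + 1)) =
          (1 + √L) ^ 2 := by
        rw [hcast, hr, Real.sq_sqrt (by positivity), mul_pow, mul_pow, mul_pow,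
          Real.sq_sqrt zero_le_two, Real.sq_sqrt (by positivity), pow_succ]
        field_simp
        ring
      rw [hexp]
      have hsL : 1 ≤ √L := Real.one_le_sqrt.2 hL1
      have hsL2 : √L ^ 2 = L := Real.sq_sqrt (by linarith)
      -- Since `L ≥ 1`, `(1 + √L)² ≥ 3 + L`. The first term of `γ` thus pays for the factor `e⁻³`,
      -- which absorbs the prefactor `2` and the loss in summing over epochs.
      calc 2 * Real.exp (-(1 + √L) ^ 2) ≤ 2 * Real.exp (-3 + -L) := by
            gcongr
            nlinarith
        _ = 2 * (Real.exp (-3) * (g k * (2 / δ))⁻¹) := by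
            rw [Real.exp_add, Real.exp_neg L, hL, Real.exp_add, Real.exp_log hgk0,
              Real.exp_log (by positivity)]
        _ = _ := by field_simp

/-- With probability at least `1 - δ / 4`, the empirical mean of a fixed function of the unit ball
stays above its mean minus `2 √B κ_t` at all times. -/
theorem IsIIDSample.measure_exists_kappaOne_lt_le [IsProbabilityMeasure μ]
    [IsProbabilityMeasure P] (hZ : IsIIDSample Z P μ) (hK : IsMercerKernel K)
    (hker : RKHS.kernel H = kernelMatrix K) (hB : ∀ x y, K x y ≤ B) {l : ℝ → ℝ}
    (hl : IsStitchingOne l) {δ : ℝ} (hδ0 : 0 < δ) (hδ1 : δ < 1) {f : H} (hf : ‖f‖ ≤ 1) :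
    μ {ω | ∃ t, 1 ≤ t ∧ 2 * √B * kappaOne l δ t <
        inner ℝ f (meanEmbedding H P - meanEmbedding H (empMeasure Z t ω))} ≤
      ENNReal.ofReal (δ / 4) := by
  have hB0 := nonneg_of_kernel_le hK hB
  have hfc : Continuous f := by
    have : Continuous fun x => inner ℝ f (rkhsFeature H x) :=
      continuous_const.inner (hK.continuous_rkhsFeature hker)
    simpa only [inner_rkhsFeature] using this
  have hfb : ∀ x, |f x| ≤ √B := fun x => by
    rw [← inner_rkhsFeature]
    refine (abs_real_inner_le_norm _ _).trans ?_
    exact (mul_le_of_le_one_left (norm_nonneg _) hf).trans (norm_rkhsFeature_le hker hB x)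
  have hfi : Integrable f P := Integrable.of_bound hfc.stronglyMeasurable.aestronglyMeasurable
    (√B) (Filter.Eventually.of_forall fun x => hfb x)
  set a := ∫ x, f x ∂P with ha
  have hab : |a| ≤ √B := by
    have := norm_integral_le_of_norm_le_const (μ := P) (f := fun x => f x) (C := √B)
      (Filter.Eventually.of_forall fun x => hfb x)
    simpa using this
  -- The sign is chosen so that the one-sided bound controls the mean minus the empirical mean.
  set φ : Eucl d → ℝ := fun x => a - f x with hφ
  have hφm : StronglyMeasurable φ := (continuous_const.sub hfc).stronglyMeasurable
  have hφb : ∀ x, ‖φ x‖ ≤ 2 * √B := fun x => by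
    refine (abs_sub _ _).trans ?_
    linarith [hfb x]
  have hφ0 : ∫ x, φ x ∂P = 0 := by
    rw [hφ, integral_sub (integrable_const _) hfi]
    simp [ha]
  have hdiff := hZ.isBoundedMartingaleDiff hφm hφb hφ0
  have hinner : ∀ t, 1 ≤ t → ∀ ω,
      inner ℝ f (meanEmbedding H P - meanEmbedding H (empMeasure Z t ω)) =
        (t : ℝ)⁻¹ * ∑ i ∈ Finset.range t, φ (Z i ω) := by
    intro t ht ω
    rw [← neg_sub (meanEmbedding H (empMeasure Z t ω)), meanEmbedding_empMeasure_sub t ht,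
      inner_neg_right, real_inner_smul_right, inner_sum, ← mul_neg, ← Finset.sum_neg_distrib]
    congr 1
    refine Finset.sum_congr rfl fun i _ => ?_
    rw [inner_sub_right, inner_rkhsFeature,
      ← integral_coe_eq_inner_meanEmbedding (hK.integrable_rkhsFeature hker hB P)]
    ring
  have hbad : ∀ t, 1 ≤ t → ∀ ω, 2 * √B * kappaOne l δ t <
      inner ℝ f (meanEmbedding H P - meanEmbedding H (empMeasure Z t ω)) →
      t * (2 * √B * kappaOne l δ t) < ∑ i ∈ Finset.range t, φ (Z i ω) := by
    intro t ht ω h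
    have ht' : (0 : ℝ) < t := by exact_mod_cast ht
    rwa [hinner t ht, lt_inv_mul_iff₀ ht'] at h
  have hlog4 : 1 ≤ Real.log (4 / δ) := by
    rw [Real.le_log_iff_exp_le (by positivity), le_div_iff₀ hδ0]
    have := Real.exp_one_lt_d9
    nlinarith
  refine measure_exists_one_le_le_of_dyadic_succ
    (c := fun k : ℕ => δ / 4 * (1 / l ((k : ℝ) + 1)))
    (fun k => ?_) (hl.summable.mul_left _) ?_ (fun ω h => ?_) fun k => ?_
  · have := hl.one_le ((k : ℝ) + 1) (by positivity)
    positivity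
  · rw [tsum_mul_left]
    exact mul_le_of_le_one_right (by positivity) hl.tsum_le
  -- The series for `l` starts at `1`, leaving no weight for the epoch `{1}`. There `κ₁ ≥ 1`, so the
  -- trivial bound `2 √B` suffices.
  · have h' := hbad 1 le_rfl ω h
    have hz : ‖∑ i ∈ Finset.range 1, φ (Z i ω)‖ ≤ (1 : ℕ) * (2 * √B) := hdiff.norm_sum_le 1 ω
    have hκ1 : 1 ≤ kappaOne l δ 1 := by
      unfold kappaOne
      rw [Real.one_le_sqrt]
      have := Real.log_nonneg (hl.one_le 0 le_rfl)
      simp only [Nat.cast_one, Real.logb_one, div_one]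
      linarith
    have := (Real.le_norm_self _).trans hz
    have : 2 * √B ≤ 2 * √B * kappaOne l δ 1 := le_mul_of_one_le_right (by positivity) hκ1
    simp only [Nat.cast_one, one_mul] at *
    linarith
  · rcases hB0.eq_or_lt with hB00 | hBpos
    · refine (measure_mono_null ?_ measure_empty).le.trans zero_le
      rintro ω ⟨t, ht, -, h⟩
      have h' := hbad t (Nat.one_le_two_pow.trans ht) ω h
      have hz : ‖∑ i ∈ Finset.range t, φ (Z i ω)‖ ≤ t * (2 * √B) := hdiff.norm_sum_le t ω
      have := (Real.le_norm_self _).trans hz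
      rw [← hB00, Real.sqrt_zero, mul_zero, mul_zero] at this
      rw [← hB00, Real.sqrt_zero, mul_zero, zero_mul, mul_zero] at h'
      linarith
    have hl1 := hl.one_le ((k : ℝ) + 1) (by positivity)
    have hl0 : 0 < l ((k : ℝ) + 1) := zero_lt_one.trans_le hl1
    set L := Real.log (l ((k : ℝ) + 1)) + Real.log (4 / δ) with hL
    have hL0 : 0 ≤ L := by linarith [Real.log_nonneg hl1]
    set r := 2 * √(B * 2 ^ (k + 1) * L) with hr
    have hr0 : 0 ≤ r := by positivity
    -- Hoeffding's lemma for `-f`, with values in `[-√B, √B]`, gives variance proxy `B`. Using the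
    -- increment bound `2 √B` of `φ` instead would give `4B`.
    have hsg : ∀ i, HasSubgaussianMGF (fun ω => φ (Z i ω)) B.toNNReal μ := by
      intro i
      have h := hasSubgaussianMGF_of_mem_Icc (μ := μ) (X := fun ω => -f (Z i ω)) (a := -√B)
        (b := √B) (hfc.neg.measurable.comp (hZ.measurable i)).aemeasurable
        (Filter.Eventually.of_forall fun ω => by
          have := abs_le.1 (hfb (Z i ω))
          constructor <;> linarith)
      have hc : (‖√B - -√B‖₊ / 2) ^ 2 = B.toNNReal := by
        ext
        simp only [NNReal.coe_pow, NNReal.coe_div, coe_nnnorm, NNReal.coe_ofNat, Real.coe_toNNReal B hB0]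
        rw [Real.norm_of_nonneg (by linarith [Real.sqrt_nonneg B])]
        ring_nf
        exact Real.sq_sqrt hB0
      rw [hc] at h
      refine h.congr (Filter.Eventually.of_forall fun ω => ?_)
      have : ∫ ω, -f (Z i ω) ∂μ = -a := by
        rw [integral_neg, hZ.integral_comp hfc.stronglyMeasurable i]
      simp only [this, hφ]
      ring
    have hmain := hdiff.measure_exists_le_sum_le
      (hZ.indep.comp (fun _ => φ) fun _ => hφm.measurable) (v := B.toNNReal)
      (Real.toNNReal_pos.2 hBpos) hsg hr0
      (2 ^ (k + 1 + 1) - 1)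
    refine (measure_mono ?_).trans (hmain.trans (ENNReal.ofReal_le_ofReal ?_))
    · rintro ω ⟨t, ht1, ht2, h⟩
      have ht : 1 ≤ t := Nat.one_le_two_pow.trans ht1
      refine ⟨t - 1, by omega, ?_⟩
      rw [Nat.sub_add_cancel ht]
      refine le_trans ?_ (hbad t ht ω h).le
      have ht' : (0 : ℝ) < t := by exact_mod_cast ht
      have htk : (2 : ℝ) ^ (k + 1) ≤ t := by exact_mod_cast ht1
      have hk := le_logb_two_of_pow_le ht1
      push_cast at hk
      have hk0 : (0 : ℝ) ≤ (k : ℝ) + 1 := by positivity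
      have hLM : L ≤ Real.log (l (Real.logb 2 t)) + Real.log (4 / δ) := by
        have := Real.log_le_log hl0
          (hl.mono (Set.mem_Ici.2 hk0) (Set.mem_Ici.2 (hk0.trans hk)) hk)
        simp only [hL]; linarith
      have e1 : (t : ℝ) * (2 * √B * kappaOne l δ t) =
          2 * √(B * t * (Real.log (l (Real.logb 2 t)) + Real.log (4 / δ))) := by
        unfold kappaOne
        set M := Real.log (l (Real.logb 2 t)) + Real.log (4 / δ)
        have : B * t * M = t ^ 2 * (B * (M / t)) := by field_simp
        rw [this, Real.sqrt_mul (by positivity), Real.sqrt_sq ht'.le, Real.sqrt_mul hB0]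
        ring
      rw [e1, hr]
      gcongr
    · have hcast : ((2 ^ (k + 1 + 1) - 1 : ℕ) : ℝ) + 1 = 2 ^ (k + 1 + 1) := by
        rw [← Nat.cast_add_one, Nat.sub_add_cancel Nat.one_le_two_pow]; push_cast; rfl
      have hexp : r ^ 2 / (2 * (B.toNNReal : ℝ) *
          (((2 ^ (k + 1 + 1) - 1 : ℕ) : ℝ) + 1)) = L := by
        rw [hcast, hr, mul_pow, Real.sq_sqrt (by positivity), Real.coe_toNNReal B hB0,
          pow_succ (2 : ℝ) (k + 1)]
        field_simp
      rw [hexp, Real.exp_neg, hL, Real.exp_add, Real.exp_log hl0, Real.exp_log (by positivity)]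
      apply le_of_eq
      field_simp

end OneSample

/-! ### The two-sample bound -/

theorem mmd_eq_norm_meanEmbedding_sub {d : ℕ} {K : Eucl d → Eucl d → ℝ} (hK : IsMercerKernel K)
    [Fact (kernelMatrix K).PosSemidef] {B : ℝ} (hB : ∀ x y, K x y ≤ B) (P Q : Measure (Eucl d))
    [IsFiniteMeasure P] [IsFiniteMeasure Q] :
    mmd hK P Q = ‖meanEmbedding (RKHS.OfKernel (kernelMatrix K)) P -
      meanEmbedding (RKHS.OfKernel (kernelMatrix K)) Q‖ :=
  ipm_rkhsUnitBall (hK.integrable_rkhsFeature RKHS.OfKernel.kernel_ofKernel hB P)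
    (hK.integrable_rkhsFeature RKHS.OfKernel.kernel_ofKernel hB Q)

/-- Monotonicity of `g` replaces both logarithms by the joint one, and `√a + √b ≤ √2 √(a + b)` turns
`2√2` into `4`. -/
theorem gammaOne_add_gammaOne_le {g : ℝ → ℝ} (hg : IsStitchingTwo g) {B δ : ℝ} (hB0 : 0 ≤ B)
    {t s : ℕ} (ht : 1 ≤ t) (hs : 1 ≤ s) :
    gammaOne g B δ t + gammaOne g B δ s ≤ gammaMMD g B δ t s := by
  have ht' : (1 : ℝ) ≤ t := by exact_mod_cast ht
  have hs' : (1 : ℝ) ≤ s := by exact_mod_cast hs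
  have hlt : 0 ≤ Real.logb 2 t := Real.logb_nonneg one_lt_two ht'
  have hls : 0 ≤ Real.logb 2 s := Real.logb_nonneg one_lt_two hs'
  have hlog : ∀ x, 0 ≤ x → x ≤ Real.logb 2 t + Real.logb 2 s →
      Real.log (g x) ≤ Real.log (g (Real.logb 2 t + Real.logb 2 s)) := fun x hx h =>
    Real.log_le_log (zero_lt_one.trans_le (hg.one_le x hx))
      (hg.mono (Set.mem_Ici.2 hx) (Set.mem_Ici.2 (hx.trans h)) h)
  set L := Real.log (g (Real.logb 2 t + Real.logb 2 s)) + Real.log (2 / δ) with hL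
  have h1 : √(B * (Real.log (g (Real.logb 2 t)) + Real.log (2 / δ)) / t) ≤ √(B * L / t) := by
    have := hlog _ hlt (by linarith)
    gcongr
    simp only [hL]; linarith
  have h2 : √(B * (Real.log (g (Real.logb 2 s)) + Real.log (2 / δ)) / s) ≤ √(B * L / s) := by
    have := hlog _ hls (by linarith)
    gcongr
    simp only [hL]; linarith
  have h3 : √(B * L / t) + √(B * L / s) ≤ √2 * √(B * ((t : ℝ) + s) / ((t : ℝ) * s) * L) := by
    have e : B * ((t : ℝ) + s) / ((t : ℝ) * s) * L = B * L / t + B * L / s := by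
      field_simp
      ring
    rw [e, ← Real.sqrt_mul zero_le_two]
    -- Here `δ` is unrestricted, so `L` may be negative; both roots on the left are then zero.
    rcases le_or_gt 0 (B * L) with hBL | hBL
    · have ha : 0 ≤ B * L / t := by positivity
      have hb : 0 ≤ B * L / s := by positivity
      refine Real.le_sqrt_of_sq_le ?_
      nlinarith [sq_nonneg (√(B * L / t) - √(B * L / s)), Real.sq_sqrt ha, Real.sq_sqrt hb]
    · rw [Real.sqrt_eq_zero_of_nonpos (div_nonpos_of_nonpos_of_nonneg hBL.le (by positivity)),
        Real.sqrt_eq_zero_of_nonpos (div_nonpos_of_nonpos_of_nonneg hBL.le (by positivity)),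
        add_zero]
      exact Real.sqrt_nonneg _
  unfold gammaOne gammaMMD
  rw [← hL]
  have h22 : √2 * √2 = (2 : ℝ) := Real.mul_self_sqrt zero_le_two
  have h4 : 2 * √2 * (√(B * L / t) + √(B * L / s)) ≤
      4 * √(B * ((t : ℝ) + s) / ((t : ℝ) * s) * L) := by
    calc _ ≤ 2 * √2 * (√2 * √(B * ((t : ℝ) + s) / ((t : ℝ) * s) * L)) := by gcongr
      _ = 2 * (√2 * √2) * √(B * ((t : ℝ) + s) / ((t : ℝ) * s) * L) := by ring
      _ = _ := by rw [h22]; ring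
  have h5 : 2 * √2 * √(B * (Real.log (g (Real.logb 2 t)) + Real.log (2 / δ)) / t) ≤
      2 * √2 * √(B * L / t) := by gcongr
  have h6 : 2 * √2 * √(B * (Real.log (g (Real.logb 2 s)) + Real.log (2 / δ)) / s) ≤
      2 * √2 * √(B * L / s) := by gcongr
  linarith

theorem measure_union_four_le {Ω : Type*} [MeasurableSpace Ω] {μ : Measure Ω} {δ : ℝ}
    (hδ : 0 ≤ δ) {s₁ s₂ s₃ s₄ : Set Ω} (h₁ : μ s₁ ≤ ENNReal.ofReal (δ / 4))
    (h₂ : μ s₂ ≤ ENNReal.ofReal (δ / 4)) (h₃ : μ s₃ ≤ ENNReal.ofReal (δ / 4))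
    (h₄ : μ s₄ ≤ ENNReal.ofReal (δ / 4)) :
    μ (s₁ ∪ s₂ ∪ (s₃ ∪ s₄)) ≤ ENNReal.ofReal δ := by
  have h0 : 0 ≤ δ / 4 := by positivity
  calc _ ≤ μ s₁ + μ s₂ + (μ s₃ + μ s₄) :=
        (measure_union_le _ _).trans (add_le_add (measure_union_le _ _) (measure_union_le _ _))
    _ ≤ ENNReal.ofReal (δ / 4) + ENNReal.ofReal (δ / 4) +
          (ENNReal.ofReal (δ / 4) + ENNReal.ofReal (δ / 4)) := by gcongr
    _ = _ := by
        rw [← ENNReal.ofReal_add h0 h0, ← ENNReal.ofReal_add (by positivity) (by positivity)]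
        congr 1
        ring

/-- Only subadditivity enters, so the event need not be measurable. -/
theorem one_sub_le_measure_of_compl_le {Ω : Type*} [MeasurableSpace Ω] {μ : Measure Ω}
    [IsProbabilityMeasure μ] {δ : ℝ} (hδ : 0 ≤ δ) {s : Set Ω}
    (h : μ sᶜ ≤ ENNReal.ofReal δ) : ENNReal.ofReal (1 - δ) ≤ μ s := by
  rw [ENNReal.ofReal_sub _ hδ, ENNReal.ofReal_one, tsub_le_iff_right]
  calc 1 = μ (s ∪ sᶜ) := by rw [Set.union_compl_self, measure_univ]
    _ ≤ μ s + μ sᶜ := measure_union_le _ _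
    _ ≤ _ := by gcongr

/-! ### The law of the iterated logarithm rate -/

/-- Domination by one power makes the logarithm affine in `log (1 + x)`. -/
theorem Polynomial.exists_eval_le_mul_one_add_pow (p : Polynomial ℝ) :
    ∃ A : ℝ, 1 ≤ A ∧ ∀ x : ℝ, 0 ≤ x → p.eval x ≤ A * (1 + x) ^ p.natDegree := by
  refine ⟨1 + ∑ i ∈ Finset.range (p.natDegree + 1), |p.coeff i|,
    le_add_of_nonneg_right (Finset.sum_nonneg fun _ _ => abs_nonneg _), fun x hx => ?_⟩
  rw [Polynomial.eval_eq_sum_range]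
  have h1 : ∑ i ∈ Finset.range (p.natDegree + 1), p.coeff i * x ^ i ≤
      ∑ i ∈ Finset.range (p.natDegree + 1), |p.coeff i| * (1 + x) ^ p.natDegree := by
    refine Finset.sum_le_sum fun i hi => ?_
    have h2 : x ^ i ≤ (1 + x) ^ p.natDegree :=
      (pow_le_pow_left₀ hx (by linarith) i).trans
        (pow_le_pow_right₀ (by linarith) (Nat.lt_succ_iff.1 (Finset.mem_range.1 hi)))
    exact mul_le_mul (le_abs_self _) h2 (by positivity) (abs_nonneg _)
  rw [← Finset.sum_mul] at h1
  have h3 : 0 ≤ (1 + x) ^ p.natDegree := by positivity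
  linarith

theorem exists_gammaMMD_le {g : ℝ → ℝ} (hg : IsStitchingTwo g) {B δ : ℝ} (hB0 : 0 ≤ B)
    (hδ0 : 0 < δ) (hδ1 : δ < 1) (hp : ∃ p : Polynomial ℝ, ∀ x : ℝ, 0 ≤ x → g x ≤ p.eval x) :
    ∃ C : ℝ, ∀ t s : ℕ, 1 ≤ t → 1 ≤ s → 3 ≤ max t s →
      gammaMMD g B δ t s ≤
        C * √(Real.log (Real.log ((max t s : ℕ) : ℝ)) / ((min t s : ℕ) : ℝ)) := by
  obtain ⟨p, hp⟩ := hp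
  obtain ⟨A, hA1, hA⟩ := p.exists_eval_le_mul_one_add_pow
  set k := p.natDegree with hk
  have hlog2 : 0 < Real.log 2 := Real.log_pos one_lt_two
  set D : ℝ := 1 + 2 / Real.log 2 with hD
  have hD1 : 1 ≤ D := le_add_of_nonneg_right (by positivity)
  have hlog3 : 1 < Real.log 3 := by
    rw [Real.lt_log_iff_exp_lt (by norm_num)]
    exact Real.exp_one_lt_d9.trans (by norm_num)
  -- As `3 > e`, this is a positive lower bound for the iterated logarithm; dividing by it absorbs
  -- the constant terms into the rate.
  set ε : ℝ := Real.log (Real.log 3) with hε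
  have hε0 : 0 < ε := Real.log_pos hlog3
  set c : ℝ := Real.log A + k * Real.log D + Real.log (2 / δ) with hc
  have hc0 : 0 ≤ c := by
    have := Real.log_nonneg hA1
    have := Real.log_nonneg hD1
    have := log_two_div_nonneg hδ0 hδ1
    positivity
  set C₁ : ℝ := c / ε + k with hC₁
  have hC₁0 : 0 ≤ C₁ := by positivity
  refine ⟨4 * √(2 * B) / √ε + 4 * √(2 * B * C₁), fun t s ht hs hmax => ?_⟩
  set M := max t s with hM
  set m := min t s with hm
  have hm1 : 1 ≤ m := le_min ht hs
  have hm' : (1 : ℝ) ≤ m := by exact_mod_cast hm1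
  have ht' : (1 : ℝ) ≤ t := by exact_mod_cast ht
  have hs' : (1 : ℝ) ≤ s := by exact_mod_cast hs
  have hM3 : (3 : ℝ) ≤ M := by exact_mod_cast hmax
  have htM : (t : ℝ) ≤ M := by exact_mod_cast le_max_left t s
  have hsM : (s : ℝ) ≤ M := by exact_mod_cast le_max_right t s
  have hmt : (m : ℝ) ≤ t := by exact_mod_cast min_le_left t s
  have hms : (m : ℝ) ≤ s := by exact_mod_cast min_le_right t s
  have hlogM : 1 < Real.log M := hlog3.trans_le (Real.log_le_log (by norm_num) hM3)
  set LL := Real.log (Real.log M) with hLL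
  have hεLL : ε ≤ LL := Real.log_le_log (by linarith) (Real.log_le_log (by norm_num) hM3)
  have hLL0 : 0 < LL := hε0.trans_le hεLL
  set x := Real.logb 2 t + Real.logb 2 s with hx
  have hx0 : 0 ≤ x := add_nonneg (Real.logb_nonneg one_lt_two ht') (Real.logb_nonneg one_lt_two hs')
  have hxD : 1 + x ≤ D * Real.log M := by
    have h1 : Real.logb 2 t ≤ Real.log M / Real.log 2 := by
      rw [Real.logb]; gcongr
    have h2 : Real.logb 2 s ≤ Real.log M / Real.log 2 := by
      rw [Real.logb]; gcongr
    calc 1 + x ≤ Real.log M + 2 * (Real.log M / Real.log 2) := by simp only [hx]; linarith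
      _ = _ := by rw [hD]; ring
  have hN : Real.log (g x) + Real.log (2 / δ) ≤ C₁ * LL := by
    have hgx : Real.log (g x) ≤ Real.log A + k * (Real.log D + LL) := by
      have h1 : g x ≤ A * (D * Real.log M) ^ k :=
        (hp x hx0).trans ((hA x hx0).trans (by gcongr))
      refine (Real.log_le_log (zero_lt_one.trans_le (hg.one_le x hx0)) h1).trans (le_of_eq ?_)
      rw [Real.log_mul (by positivity) (by positivity), Real.log_pow,
        Real.log_mul (by positivity) (by positivity)]
    have hcLL : c ≤ c / ε * LL := by
      rw [div_mul_eq_mul_div, le_div_iff₀ hε0]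
      gcongr
    calc _ ≤ c + k * LL := by rw [hc]; linarith
      _ ≤ c / ε * LL + k * LL := by gcongr
      _ = _ := by rw [hC₁]; ring
  have hfirst : ∀ n : ℕ, (m : ℝ) ≤ n → (n : ℝ) ^ (-(1 / 2) : ℝ) ≤ √(LL / m) / √ε := by
    intro n hn
    rw [rpow_neg_half, ← Real.sqrt_inv, ← Real.sqrt_div' _ hε0.le]
    refine Real.sqrt_le_sqrt ?_
    calc (n : ℝ)⁻¹ ≤ (m : ℝ)⁻¹ := by gcongr
      _ = ε / m / ε := by field_simp
      _ ≤ _ := by gcongr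
  have hsecond : √(B * ((t : ℝ) + s) / ((t : ℝ) * s) *
      (Real.log (g x) + Real.log (2 / δ))) ≤ √(2 * B * C₁) * √(LL / m) := by
    rw [← Real.sqrt_mul (by positivity)]
    refine Real.sqrt_le_sqrt ?_
    have h1 : B * ((t : ℝ) + s) / ((t : ℝ) * s) = B * ((t : ℝ)⁻¹ + (s : ℝ)⁻¹) := by
      field_simp
      ring
    have h2 : (t : ℝ)⁻¹ + (s : ℝ)⁻¹ ≤ (m : ℝ)⁻¹ + (m : ℝ)⁻¹ := by gcongr
    rw [h1]
    calc _ ≤ B * ((t : ℝ)⁻¹ + (s : ℝ)⁻¹) * (C₁ * LL) := by gcongr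
      _ ≤ B * ((m : ℝ)⁻¹ + (m : ℝ)⁻¹) * (C₁ * LL) := by gcongr
      _ = _ := by ring
  unfold gammaMMD
  calc _ ≤ 2 * √(2 * B) * (√(LL / m) / √ε + √(LL / m) / √ε) +
        4 * (√(2 * B * C₁) * √(LL / m)) := by
        gcongr
        · exact hfirst t hmt
        · exact hfirst s hms
    _ = _ := by ring

/-! ### The main theorem. -/

theorem corollary4p3 {Ω : Type*} [MeasurableSpace Ω] (μ : Measure Ω) [IsProbabilityMeasure μ]
    (d : ℕ) (P Q : Measure (Eucl d)) [IsProbabilityMeasure P] [IsProbabilityMeasure Q]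
    (X Y : ℕ → Ω → Eucl d)
    (hX : IsIIDSample X P μ) (hY : IsIIDSample Y Q μ)
    (hXY : IndepFun (fun ω i => X i ω) (fun ω j => Y j ω) μ)
    (K : Eucl d → Eucl d → ℝ) (hK : IsMercerKernel K)
    (B : ℝ) (hB : ∀ x y, K x y ≤ B)
    (l g : ℝ → ℝ) (hl : IsStitchingOne l) (hg : IsStitchingTwo g)
    (δ : ℝ) (hδ0 : 0 < δ) (hδ1 : δ < 1) :
    ENNReal.ofReal (1 - δ) ≤
      μ {ω | ∀ t s : ℕ, 1 ≤ t → 1 ≤ s →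
        -gammaMMD g B δ t s ≤
            mmd hK P Q - mmd hK (empMeasure X t ω) (empMeasure Y s ω) ∧
          mmd hK P Q - mmd hK (empMeasure X t ω) (empMeasure Y s ω) ≤
            2 * √B * kappaTwo l δ t s} ∧
    ((∃ p : Polynomial ℝ, ∀ x : ℝ, 0 ≤ x → g x ≤ p.eval x) →
      ∃ C : ℝ, ∀ t s : ℕ, 1 ≤ t → 1 ≤ s → 3 ≤ max t s →
        gammaMMD g B δ t s ≤
          C * √(Real.log (Real.log ((max t s : ℕ) : ℝ)) / ((min t s : ℕ) : ℝ))) := by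
  have hB0 := nonneg_of_kernel_le hK hB
  refine ⟨?_, exists_gammaMMD_le hg hB0 hδ0 hδ1⟩
  have : Fact (kernelMatrix K).PosSemidef := ⟨hK.posSemidef_kernelMatrix⟩
  set H := RKHS.OfKernel (kernelMatrix K)
  have hker : RKHS.kernel H = kernelMatrix K := RKHS.OfKernel.kernel_ofKernel
  obtain ⟨f, hf1, hf⟩ :=
    exists_norm_le_one_inner_eq_norm (meanEmbedding H P - meanEmbedding H Q)
  have hX₁ := hX.measure_exists_gammaOne_lt_le hK hker hB hg hδ0 hδ1
  have hY₁ := hY.measure_exists_gammaOne_lt_le hK hker hB hg hδ0 hδ1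
  have hX₂ := hX.measure_exists_kappaOne_lt_le hK hker hB hl hδ0 hδ1 hf1
  -- The second sample enters the MMD with a minus sign, so the one-sided bound is applied to `-f`.
  have hY₂ := hY.measure_exists_kappaOne_lt_le hK hker hB hl hδ0 hδ1
    (f := -f) (by rwa [norm_neg])
  refine one_sub_le_measure_of_compl_le hδ0.le
    ((measure_mono ?_).trans (measure_union_four_le hδ0.le hX₁ hY₁ hX₂ hY₂))
  rw [Set.compl_subset_comm]
  intro ω hω t s ht hs
  simp only [Set.mem_compl_iff, Set.mem_union, Set.mem_ofPred_eq, not_or, not_exists, not_and,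
    not_lt] at hω
  obtain ⟨⟨h1, h2⟩, h3, h4⟩ := hω
  have : NeZero t := ⟨by omega⟩
  have : NeZero s := ⟨by omega⟩
  rw [mmd_eq_norm_meanEmbedding_sub hK hB, mmd_eq_norm_meanEmbedding_sub hK hB]
  set a := meanEmbedding H P
  set b := meanEmbedding H Q
  set a' := meanEmbedding H (empMeasure X t ω)
  set b' := meanEmbedding H (empMeasure Y s ω)
  constructor
  · have htri : ‖a' - b'‖ ≤ ‖a - b‖ + ‖a' - a‖ + ‖b' - b‖ := by
      calc ‖a' - b'‖ = ‖(a - b) + (a' - a) - (b' - b)‖ := by congr 1; abel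
        _ ≤ _ := (norm_sub_le _ _).trans (add_le_add_left (norm_add_le _ _) _)
    have := gammaOne_add_gammaOne_le (δ := δ) hg hB0 ht hs
    linarith [h1 t ht, h2 s hs]
  -- The population witness `f` is suboptimal for the empirical measures, so the gap in MMD is at
  -- most the gap in the mean of `f`.
  · have hle : inner ℝ f (a' - b') ≤ ‖a' - b'‖ :=
      (real_inner_le_norm _ _).trans (mul_le_of_le_one_left (norm_nonneg _) hf1)
    have hX' := h3 t ht
    have hY' := h4 s hs
    rw [inner_sub_right] at hle hX'
    rw [inner_neg_left, inner_sub_right] at hY'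
    rw [inner_sub_right] at hf
    unfold kappaTwo
    rw [mul_add]
    linarith
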